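/- For a real number $\lambda>1$ let $\Lambda=\{\pm\lambda^n : n\in\mathbb Z\}$. Let $F$ be the real vector space of absolutely summable functions $f:\Lambda\to\mathbb C$ with $f(-k)=\overline{f(k)}$; put $(f,g)=\sum_{k\in\Lambda}f(k)\overline{g(k)}$ and $\partial f(k)=ik f(k)$. For $p\in\Lambda$ let $\delta_p:\Lambda\to\mathbb C$ be the function equal to $1$ at $p$ and $0$ elsewhere. Consider the following three cases. (i) $\lambda=2$. (ii) $\lambda=\sigma=\dfrac{\sqrt[3]{9+\sqrt{69}}+\sqrt[3]{9-\sqrt{69}}}{\sqrt[3]{18}}$, the plastic number; it satisfies $1=\sigma^3-\sigma=\sigma^5-\sigma^4$. (iii) $1=\lambda^b-\lambda^a$ with coprime integers $0\le a<b\le 62$ and $(a,b)\notin\{(0,1),(1,3),(4,5)\}$. For integers $a,b$ define, for $f,g:\Lambda\to\mathbb C$ and $k\in\Lambda$, $$S_{a,b}(f,g)(k)=\sum_{j=1}^{6}f(p_jk)\,g(q_jk),$$ where $(p_j,q_j)$ runs over the six pairs $(\lambda^b,-\lambda^a)$, $(-\lambda^a,\lambda^b)$, $(\lambda^{b-a},-\lambda^{-a})$,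 $(-\lambda^{-a},\lambda^{b-a})$, $(\lambda^{-b},\lambda^{a-b})$, $(\lambda^{a-b},\lambda^{-b})$. (A) In each of the cases (i)--(iii), let $\ast:F\times F\to F$ be a binary operation, not identically zero, such that for all $f,g,h\in F$ and $\gamma\in\mathbb R$: $(f+\gamma g)\ast h=f\ast h+\gamma(g\ast h)$; $f\ast g=g\ast f$; $(f\ast g,h)=(f,g\ast h)$; $\partial(f\ast g)=\partial f\ast g+f\ast\partial g$ whenever $\partial f,\partial g\in F$; $(f\ast g)(\lambda\,\cdot)=f(\lambda\,\cdot)\ast g(\lambda\,\cdot)$; and $(f\ast g)(-\,\cdot)=f(-\,\cdot)\ast g(-\,\cdot)$. Then $\ast$ is not associative: there are $f,g,h\in F$ with $(f\ast g)\ast h\ne f\ast(g\ast h)$. (B) The same holds for the following explicit products, that is, each of them is non-associative on $F$: in case (i), $(f\ast g)(k)=c\,[f(2k)g(-k)+f(-k)g(2k)+f(k/2)g(k/2)]$ with real $c\neq0$; in case (ii), $f\ast g=c_1S_{1,3}(f,g)+c_2S_{4,5}(f,g)$ with real $(c_1,c_2)\ne(0,0)$; in case (iii), $f\ast g=c\,S_{a,b}(f,g)$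 with real $c\ne0$. (C) For the explicit products of (B), applied to arbitrary functions $\Lambda\to\mathbb C$, put $(a,b)=(0,1)$ in case (i); $(a,b)=(1,3)$ if $c_1\neq0$, and likewise $(a,b)=(4,5)$ if $c_2\ne0$, in case (ii); and the given $(a,b)$ in case (iii). Then $1+\lambda^b\notin\Lambda$, and with $p=\lambda^{2b}$, $q=-\lambda^{a+b}$, $r=-\lambda^a$, $$(\delta_p\ast\delta_q)\ast\delta_r\neq\delta_p\ast(\delta_q\ast\delta_r).$$ -/

import Mathlib

noncomputable section

/-- The logarithmic lattice `{± lam ^ n : n ∈ ℤ}` with spacing factor `lam`. -/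
def logLattice (lam : ℝ) : Set ℝ := {k | ∃ n : ℤ, k = lam ^ n ∨ k = -lam ^ n}

namespace LogLattice

theorem neg_mem {lam k : ℝ} (hk : k ∈ logLattice lam) : -k ∈ logLattice lam := by
  obtain ⟨n, h | h⟩ := hk
  · exact ⟨n, Or.inr (by rw [h])⟩
  · exact ⟨n, Or.inl (by rw [h, neg_neg])⟩

theorem zpow_mul_zpow_mem (lam : ℝ) (m n : ℤ) : lam ^ m * lam ^ n ∈ logLattice lam := by
  by_cases h0 : lam = 0
  · by_cases hm : m = 0
    · exact ⟨n, Or.inl (by simp [hm])⟩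
    · exact ⟨m, Or.inl (by simp [h0, zero_zpow m hm])⟩
  · exact ⟨m + n, Or.inl (zpow_add₀ h0 m n).symm⟩

theorem mul_mem {lam k l : ℝ} (hk : k ∈ logLattice lam) (hl : l ∈ logLattice lam) :
    k * l ∈ logLattice lam := by
  obtain ⟨m, h | h⟩ := hk <;> obtain ⟨n, h' | h'⟩ := hl <;> subst h <;> subst h'
  · exact zpow_mul_zpow_mem lam m n
  · rw [mul_neg]
    exact neg_mem (zpow_mul_zpow_mem lam m n)
  · rw [neg_mul]
    exact neg_mem (zpow_mul_zpow_mem lam m n)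
  · rw [neg_mul_neg]
    exact zpow_mul_zpow_mem lam m n

instance (lam : ℝ) : Neg (logLattice lam) := ⟨fun k => ⟨-k.1, neg_mem k.2⟩⟩

instance (lam : ℝ) : Mul (logLattice lam) := ⟨fun k l => ⟨k.1 * l.1, mul_mem k.2 l.2⟩⟩

/-- The lattice point `lam ^ n`. -/
def pt (lam : ℝ) (n : ℤ) : logLattice lam := ⟨lam ^ n, n, Or.inl rfl⟩

/-- The function with value `1` at `p` and `0` at all other lattice points. -/
def delta {lam : ℝ} (p : logLattice lam) : logLattice lam → ℂ :=
  open Classical in fun k => if k = p then 1 else 0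

/-- The real vector space of absolutely summable functions on the lattice that satisfy the
reality condition `f (-k) = conj (f k)`. -/
def latticeFn (lam : ℝ) : Submodule ℝ (logLattice lam → ℂ) where
  carrier := {f | (∀ k, f (-k) = starRingEnd ℂ (f k)) ∧ Summable fun k => ‖f k‖}
  zero_mem' := by
    exact ⟨fun k => by simp, by simp⟩
  add_mem' := by
    rintro f g ⟨hf, hf'⟩ ⟨hg, hg'⟩
    exact ⟨fun k => by simp [hf k, hg k],
      (hf'.add hg').of_nonneg_of_le (fun _ => norm_nonneg _) fun k => norm_add_le _ _⟩
  smul_mem' := by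
    rintro c f ⟨hf, hf'⟩
    refine ⟨fun k => by simp [hf k], ?_⟩
    simpa [norm_smul] using hf'.mul_left |c|

/-- The derivative `∂ f (k) = i k f (k)`. -/
def partialD {lam : ℝ} (f : logLattice lam → ℂ) : logLattice lam → ℂ :=
  fun k => Complex.I * ((k : ℝ) : ℂ) * f k

/-- The rescaling `k ↦ f (lam k)`. -/
def rescale {lam : ℝ} (f : logLattice lam → ℂ) : logLattice lam → ℂ :=
  fun k => f (pt lam 1 * k)

/-- The reflection `k ↦ f (-k)`; together with the identity it gives all symmetries `k ↦ ± k` of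
the one-dimensional lattice. -/
def reflect {lam : ℝ} (f : logLattice lam → ℂ) : logLattice lam → ℂ :=
  fun k => f (-k)

/-- The inner product `∑ₖ f (k) conj (g (k))`. -/
def innerProd {lam : ℝ} (f g : logLattice lam → ℂ) : ℂ :=
  ∑' k, f k * starRingEnd ℂ (g k)

/-- A product on the one-dimensional logarithmic lattice with scaling invariance and parity.
The derivative of a summable function need not be summable, so the Leibniz rule is required for all
`f`, `g` whose derivatives `f'`, `g'` are again in the function space. -/
structure IsSymmetricProduct {lam : ℝ}
    (op : latticeFn lam → latticeFn lam → latticeFn lam) : Prop where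
  reality : ∀ f g : latticeFn lam, ∀ k : logLattice lam,
    (op f g).1 (-k) = starRingEnd ℂ ((op f g).1 k)
  bilinear : ∀ (f g h : latticeFn lam) (γ : ℝ), op (f + γ • g) h = op f h + γ • op g h
  comm : ∀ f g : latticeFn lam, op f g = op g f
  assoc_avg : ∀ f g h : latticeFn lam, innerProd (op f g).1 h.1 = innerProd f.1 (op g h).1
  leibniz : ∀ f g f' g' : latticeFn lam, f'.1 = partialD f.1 → g'.1 = partialD g.1 →
    partialD (op f g).1 = (op f' g).1 + (op f g').1
  scaling : ∀ f g f' g' : latticeFn lam, f'.1 = rescale f.1 → g'.1 = rescale g.1 →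
    rescale (op f g).1 = (op f' g').1
  parity : ∀ f g f' g' : latticeFn lam, f'.1 = reflect f.1 → g'.1 = reflect g.1 →
    reflect (op f g).1 = (op f' g').1

/-- The triads at unity `1 = p + q` on the lattice with spacing `2`:
`1 = 2 - 1 = -1 + 2 = 1/2 + 1/2`. -/
def dyadicTable (lam : ℝ) : Fin 3 → logLattice lam × logLattice lam :=
  ![(pt lam 1, -pt lam 0), (-pt lam 0, pt lam 1), (pt lam (-1), pt lam (-1))]

/-- The six triads at unity that come from `1 = lam ^ b - lam ^ a`. -/
def trinomialTable (lam : ℝ) (a b : ℤ) : Fin 6 → logLattice lam × logLattice lam :=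
  ![(pt lam b, -pt lam a), (-pt lam a, pt lam b),
    (pt lam (b - a), -pt lam (-a)), (-pt lam (-a), pt lam (b - a)),
    (pt lam (-b), pt lam (a - b)), (pt lam (a - b), pt lam (-b))]

/-- The operation `(f ∗ g)(k) = ∑ⱼ f (pⱼ k) g (qⱼ k)` for a list of pairs `(pⱼ, qⱼ)`. -/
def tableProd {lam : ℝ} {n : ℕ} (T : Fin n → logLattice lam × logLattice lam)
    (f g : logLattice lam → ℂ) : logLattice lam → ℂ :=
  fun k => ∑ j, f ((T j).1 * k) * g ((T j).2 * k)

/-- The plastic number. -/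
def plastic : ℝ :=
  ((9 + √69) ^ (1 / 3 : ℝ) + (9 - √69) ^ (1 / 3 : ℝ)) / (18 : ℝ) ^ (1 / 3 : ℝ)

/-- The product on the lattice with spacing `2`, with a real prefactor `c`. -/
def prodDyadic (lam c : ℝ) (f g : logLattice lam → ℂ) : logLattice lam → ℂ :=
  c • tableProd (dyadicTable lam) f g

/-- The product on the lattice with `1 = lam ^ b - lam ^ a`, with a real prefactor `c`. -/
def prodTrinomial (lam : ℝ) (a b : ℕ) (c : ℝ) (f g : logLattice lam → ℂ) : logLattice lam → ℂ :=
  c • tableProd (trinomialTable lam a b) f g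

/-- The products on the lattice whose spacing `lam` is the plastic number: its twelve triads at
unity are the six from `1 = lam ^ 3 - lam` and the six from `1 = lam ^ 5 - lam ^ 4`. -/
def prodPlastic (lam c₁ c₂ : ℝ) (f g : logLattice lam → ℂ) : logLattice lam → ℂ :=
  c₁ • tableProd (trinomialTable lam 1 3) f g + c₂ • tableProd (trinomialTable lam 4 5) f g

/-- The spacing `lam` satisfies `1 = lam ^ b - lam ^ a` with coprime `0 ≤ a < b ≤ 62`, where
the pair is not one of those that give `lam = 2` or the plastic number. -/
def IsTrinomialSpacing (lam : ℝ) (a b : ℕ) : Prop :=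
  a < b ∧ b ≤ 62 ∧ Nat.Coprime a b ∧
    (a, b) ≠ (0, 1) ∧ (a, b) ≠ (1, 3) ∧ (a, b) ≠ (4, 5) ∧ 1 = lam ^ b - lam ^ a

/-- Associativity of an operation fails for some absolutely summable functions that satisfy the
reality condition. -/
def NotAssociative {lam : ℝ}
    (op : (logLattice lam → ℂ) → (logLattice lam → ℂ) → logLattice lam → ℂ) : Prop :=
  ∃ f ∈ latticeFn lam, ∃ g ∈ latticeFn lam, ∃ h ∈ latticeFn lam,
    op (op f g) h ≠ op f (op g h)

/-- `1 + lam ^ b` is not a lattice point, and associativity of `op` fails for the delta functions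
at `p = lam ^ (2 b)`, `q = -lam ^ (a + b)`, `r = -lam ^ a`. -/
def DeltaWitness {lam : ℝ} (a b : ℕ)
    (op : (logLattice lam → ℂ) → (logLattice lam → ℂ) → logLattice lam → ℂ) : Prop :=
  1 + lam ^ b ∉ logLattice lam ∧
    op (op (delta (pt lam (2 * b))) (delta (-pt lam (a + b)))) (delta (-pt lam a)) ≠
      op (delta (pt lam (2 * b))) (op (delta (-pt lam (a + b))) (delta (-pt lam a)))

end LogLattice

end

/-! Write `δ_p * δ_q` for the product of two delta functions. The Leibniz rule forces it to be a
multiple of `δ_(p+q)`, and to vanish if `p + q` is off the lattice. If `1 = lam ^ b - lam ^ a` and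
`δ_(lam ^ b) * δ_(-lam ^ a) = c • δ_1` with `c ≠ 0`, scaling by `lam ^ b` gives `δ_p * δ_q = c •
δ_(lam ^ b)`, so `(δ_p * δ_q) * δ_r = c ^ 2 • δ_1 ≠ 0`. But `q + r = -lam ^ a * (1 + lam ^ b)`, so
`δ_q * δ_r = 0` once `1 + lam ^ b` is off the lattice (`not_associative_of_triad`).

That last fact is arithmetic (`one_add_pow_ne_pow`): for `a > 0`, `lam` is an algebraic unit and has
a conjugate in the closed unit disc, where the two relations contradict each other.

For an abstract product, adjointness, parity and scaling make nonvanishing on a triad `x + y + z =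
0` invariant under permutation, sign and dilation, so any nonzero product has a triad of the
required shape (`exists_activeTriad`, `ActiveTriad.exists_normalized`).

Delta functions violate the reality condition. The abstract product is therefore extended to complex
summable functions, and for the explicit products associativity is extended to the complex span. -/

/-! ### Arithmetic of the spacing factor. -/

open Polynomial in
/-- An algebraic unit has a conjugate of modulus at most `1`, because the product of its conjugates
is `± 1`. -/
theorem exists_conjugate_norm_le_one {x : ℝ} {P : ℤ[X]} (hx : aeval x P = 0)
    (hP : P.Monic) (h0 : IsUnit (P.coeff 0)) :
    ∃ z : ℂ, ‖z‖ ≤ 1 ∧ ∀ Q : ℤ[X], aeval x Q = 0 → aeval z Q = 0 := by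
  have hint : IsIntegral ℤ x := ⟨P, hP, hx⟩
  set p := minpoly ℤ x with hp
  have hmon : p.Monic := minpoly.monic hint
  have hdvd : ∀ Q : ℤ[X], aeval x Q = 0 → p ∣ Q := fun Q hQ =>
    minpoly.isIntegrallyClosed_dvd hint hQ
  -- The minimal polynomial divides `P`, so its constant term divides a unit.
  have hunit : IsUnit (p.coeff 0) := by
    obtain ⟨R, hR⟩ := hdvd P hx
    rw [hR, mul_coeff_zero] at h0
    exact isUnit_of_mul_isUnit_left h0
  set q : ℂ[X] := p.map (Int.castRingHom ℂ) with hq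
  have hqmon : q.Monic := hmon.map _
  have hsplit : q.Splits := IsAlgClosed.splits q
  by_contra! hcon
  have hroot : ∀ z ∈ q.roots, 1 < ‖z‖ := by
    intro z hz
    by_contra! hle
    obtain ⟨Q, hQ, hzQ⟩ := hcon z hle
    obtain ⟨R, rfl⟩ := hdvd Q hQ
    apply hzQ
    have h1 : aeval z p = 0 := by
      have := (mem_roots'.1 hz).2
      rwa [IsRoot.def, hq, eval_map] at this
    rw [map_mul, h1, zero_mul]
  have hdeg : q.natDegree ≠ 0 := by
    rw [hq, hmon.natDegree_map]
    exact (minpoly.natDegree_pos hint).ne'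
  have hcard : q.roots.card ≠ 0 := by
    rwa [← hsplit.natDegree_eq_card_roots]
  have hprod : ∀ s : Multiset ℂ, (∀ z ∈ s, 1 < ‖z‖) → s.card ≠ 0 → 1 < ‖s.prod‖ := by
    intro s
    induction s using Multiset.induction with
    | empty => simp
    | cons a s ih =>
      intro h _
      rw [Multiset.prod_cons, norm_mul]
      have ha := h a (Multiset.mem_cons_self a s)
      by_cases hs : s.card = 0
      · rw [Multiset.card_eq_zero] at hs
        simpa [hs] using ha
      · exact one_lt_mul_of_lt_of_le ha
          (ih (fun z hz => h z (Multiset.mem_cons_of_mem hz)) hs).le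
  have hlt := hprod _ hroot hcard
  have hcoeff := hsplit.coeff_zero_eq_prod_roots_of_monic hqmon
  have hn : ‖q.coeff 0‖ = 1 := by
    rw [hq, coeff_map]
    rcases Int.isUnit_iff.1 hunit with h | h <;> simp [h]
  rw [hcoeff, norm_mul] at hn
  simp at hn
  linarith

/-- The relations `1 + x ^ a = x ^ b` and `1 + x ^ b = x ^ n` have no common solution `x > 1`. -/
theorem one_add_pow_ne_pow {x : ℝ} (hx : 1 < x) {a b n : ℕ} (hab : 1 = x ^ b - x ^ a)
    (hn : n ≠ 0) : 1 + x ^ b ≠ x ^ n := by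
  intro h
  have hb : b ≠ 0 := by
    rintro rfl
    have : 0 < x ^ a := by positivity
    simp at hab; linarith
  -- For `a = 0` the number `x` is a root of `X ^ b - 2`, whose constant term is not a unit; parity
  -- of `2 ^ n = 3 ^ b` replaces the conjugate argument.
  rcases Nat.eq_zero_or_pos a with rfl | ha
  · have h2 : x ^ b = 2 := by simp at hab; linarith
    have h3 : x ^ n = 3 := by linarith
    have h4 : (2 : ℝ) ^ n = 3 ^ b := by rw [← h2, ← h3, ← pow_mul, ← pow_mul, mul_comm]
    have h5 : (2 : ℕ) ^ n = 3 ^ b := by exact_mod_cast h4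
    have h6 : Even ((2 : ℕ) ^ n) := (Nat.even_pow.2 ⟨even_two, hn⟩)
    rw [h5] at h6
    exact absurd (Nat.even_pow.1 h6).1 (by decide)
  · have hlt : a < b := by
      by_contra! hle
      have := pow_le_pow_right₀ hx.le hle
      linarith
    have hP : (Polynomial.X ^ b - Polynomial.X ^ a - 1 : Polynomial ℤ).Monic := by
      have : (Polynomial.X ^ b - Polynomial.X ^ a - 1 : Polynomial ℤ) =
        Polynomial.X ^ b + (-Polynomial.X ^ a - 1) := by ring
      rw [this]
      apply Polynomial.monic_X_pow_add
      have h1 : (-Polynomial.X ^ a - 1 : Polynomial ℤ).degree ≤ a := by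
        compute_degree!
      exact h1.trans_lt (by exact_mod_cast hlt)
    obtain ⟨z, hz, hQ⟩ := exists_conjugate_norm_le_one (x := x)
      (P := Polynomial.X ^ b - Polynomial.X ^ a - 1) (by simp; linarith) hP
      (by simp [Polynomial.coeff_X_pow, hb.symm, ha.ne])
    have e1 := hQ (Polynomial.X ^ b - Polynomial.X ^ a - 1) (by simp; linarith)
    have e2 := hQ (Polynomial.X ^ n - Polynomial.X ^ b - 1) (by simp; linarith)
    simp only [map_sub, map_pow, Polynomial.aeval_X, map_one] at e1 e2
    -- Both `z ^ a` and `2 + z ^ a` lie in the closed unit disc, which leaves only `z ^ a = -1`;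
    -- then `z ^ b = 1 + z ^ a = 0`, which is absurd.
    have e3 : z ^ n = 2 + z ^ a := by linear_combination e1 + e2
    have n1 : ‖2 + z ^ a‖ ≤ 1 := by
      rw [← e3, norm_pow]; exact pow_le_one₀ (norm_nonneg _) hz
    have n2 : ‖z ^ a‖ ≤ 1 := by
      rw [norm_pow]; exact pow_le_one₀ (norm_nonneg _) hz
    have hre : (z ^ a).re ≤ -1 := by
      have := (Complex.re_le_norm (2 + z ^ a)).trans n1
      simp at this; linarith
    have hsq : (z ^ a).re ^ 2 + (z ^ a).im ^ 2 ≤ 1 := by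
      have h1 := Complex.sq_norm (z ^ a)
      rw [Complex.normSq_apply] at h1
      nlinarith [norm_nonneg (z ^ a)]
    have him : (z ^ a).im = 0 := by nlinarith [sq_nonneg (z ^ a).im]
    have hre' : (z ^ a).re = -1 := by nlinarith [sq_nonneg (z ^ a).im]
    have hza : z ^ a = -1 := Complex.ext (by simpa using hre') (by simpa using him)
    have hzb : z ^ b = 0 := by linear_combination e1 + hza
    have hz0 : z = 0 := by simpa [hb] using hzb
    rw [hz0, zero_pow ha.ne'] at hza
    norm_num at hza

namespace LogLattice

theorem one_add_pow_notMem {lam : ℝ} (hlam : 1 < lam) {a b : ℕ}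
    (hab : 1 = lam ^ b - lam ^ a) : 1 + lam ^ b ∉ logLattice lam := by
  have h0 : 0 < lam := by linarith
  have hb : 0 < lam ^ b := by positivity
  rintro ⟨n, h | h⟩
  · have hn : 0 < n := by
      rw [← one_lt_zpow_iff_right₀ hlam, ← h]; linarith
    lift n to ℕ using hn.le
    rw [zpow_natCast] at h
    exact one_add_pow_ne_pow hlam hab (by omega) h
  · have : 0 < lam ^ n := by positivity
    linarith

/-- Cardano's formula: with `plastic = (u + v) / w` one has `u ^ 3 + v ^ 3 = w ^ 3 = 18` and `3 * u
* v = w ^ 2`, the latter because `27 * (81 - 69) = 18 ^ 2`. -/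
theorem plastic_cube : plastic ^ 3 = plastic + 1 := by
  have hs : √69 ^ 2 = 69 := Real.sq_sqrt (by norm_num)
  have hs9 : √69 < 9 := by
    rw [Real.sqrt_lt' (by norm_num)]; norm_num
  have hs0 : 0 ≤ √69 := Real.sqrt_nonneg _
  have cube : ∀ y : ℝ, 0 ≤ y → (y ^ (1 / 3 : ℝ)) ^ 3 = y := by
    intro y hy
    rw [← Real.rpow_natCast, ← Real.rpow_mul hy]
    norm_num
  have hu := cube (9 + √69) (by linarith)
  have hv := cube (9 - √69) (by linarith)
  have hw := cube 18 (by norm_num)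
  have hu0 : 0 ≤ (9 + √69) ^ (1 / 3 : ℝ) := Real.rpow_nonneg (by linarith) _
  have hv0 : 0 ≤ (9 - √69) ^ (1 / 3 : ℝ) := Real.rpow_nonneg (by linarith) _
  have hw0 : 0 < (18 : ℝ) ^ (1 / 3 : ℝ) := Real.rpow_pos_of_pos (by norm_num) _
  unfold plastic
  generalize (9 + √69) ^ (1 / 3 : ℝ) = u at *
  generalize (9 - √69) ^ (1 / 3 : ℝ) = v at *
  generalize (18 : ℝ) ^ (1 / 3 : ℝ) = w at *
  have key : 3 * (u * v) = w ^ 2 := by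
    have : (3 * (u * v)) ^ 3 = (w ^ 2) ^ 3 := by
      have e1 : (3 * (u * v)) ^ 3 = 27 * (u ^ 3 * v ^ 3) := by ring
      have e2 : (w ^ 2) ^ 3 = (w ^ 3) ^ 2 := by ring
      rw [e1, e2, hu, hv, hw]
      linear_combination -27 * hs
    exact (pow_left_inj₀ (by positivity) (by positivity) (by norm_num)).1 this
  field_simp
  linear_combination hu + hv - hw + (u + v) * key

/-! ### Lattice points, delta functions and the obstruction to associativity. -/

variable {lam : ℝ}

@[simp] theorem coe_neg (k : logLattice lam) : ((-k : logLattice lam) : ℝ) = -k := rfl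

@[simp] theorem coe_mul (k l : logLattice lam) : ((k * l : logLattice lam) : ℝ) = k * l := rfl

@[simp] theorem coe_pt (n : ℤ) : (pt lam n : ℝ) = lam ^ n := rfl

theorem pt_add (h : lam ≠ 0) (m n : ℤ) : pt lam (m + n) = pt lam m * pt lam n :=
  Subtype.ext (zpow_add₀ h m n)

protected theorem neg_neg (k : logLattice lam) : - -k = k := Subtype.ext (neg_neg _)

theorem neg_eq_iff {k l : logLattice lam} : -k = l ↔ k = -l := by
  constructor <;> rintro rfl <;> simp [LogLattice.neg_neg]

theorem coe_ne_zero (h : 0 < lam) (k : logLattice lam) : (k : ℝ) ≠ 0 := by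
  obtain ⟨k, n, rfl | rfl⟩ := k
  · exact (zpow_pos h n).ne'
  · exact neg_ne_zero.2 (zpow_pos h n).ne'

theorem delta_self (p : logLattice lam) : delta p p = 1 := by simp [delta]

theorem delta_of_ne {p k : logLattice lam} (h : k ≠ p) : delta p k = 0 := by simp [delta, h]

theorem summable_delta (p : logLattice lam) : Summable fun k => ‖delta p k‖ :=
  summable_of_ne_finset_zero (s := {p}) fun k hk => by
    rw [delta_of_ne (by simpa using hk), norm_zero]

theorem mul_neg_pt_notMem (h : 0 < lam) {a b : ℕ} (hb : 1 + lam ^ b ∉ logLattice lam) :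
    -lam ^ (a + b) + -lam ^ a ∉ logLattice lam := by
  intro hmem
  apply hb
  have := mul_mem (neg_mem hmem) (pt lam (-a)).2
  convert this using 1
  have : lam ^ a ≠ 0 := by positivity
  simp only [coe_pt, zpow_neg, zpow_natCast]
  field_simp
  ring

/-- A product for which `e p * e q` is a multiple of `e (p + q)` is not associative as soon as
`e (lam ^ b) * e (-lam ^ a)` is a nonzero multiple of `e 1`, and likewise after rescaling by
`lam ^ b`, while `1 + lam ^ b` is not a lattice point. -/
theorem not_associative_of_triad {V : Type*} [AddCommGroup V] [Module ℂ V] (h : 0 < lam)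
    (m : V → V → V) (e : logLattice lam → V) {a b : ℕ} {c : ℂ} (hc : c ≠ 0)
    (he : e (pt lam 0) ≠ 0)
    (hsmul : ∀ (z : ℂ) f g, m (z • f) g = z • m f g) (hzero : ∀ f, m f 0 = 0)
    (hone : m (e (pt lam b)) (e (-pt lam a)) = c • e (pt lam 0))
    (hscale : m (e (pt lam (2 * b))) (e (-pt lam (a + b))) = c • e (pt lam b))
    (hsupp : ∀ p q : logLattice lam, (p : ℝ) + q ∉ logLattice lam → m (e p) (e q) = 0)
    (hb : 1 + lam ^ b ∉ logLattice lam) :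
    m (m (e (pt lam (2 * b))) (e (-pt lam (a + b)))) (e (-pt lam a)) ≠
      m (e (pt lam (2 * b))) (m (e (-pt lam (a + b))) (e (-pt lam a))) := by
  have h0 : m (e (-pt lam (a + b))) (e (-pt lam a)) = 0 := by
    apply hsupp
    have := mul_neg_pt_notMem (a := a) h hb
    simpa only [coe_neg, coe_pt, ← Nat.cast_add, zpow_natCast] using this
  rw [h0, hzero, hscale, hsmul, hone]
  exact smul_ne_zero hc (smul_ne_zero hc he)

/-! ### Products given by tables of triads. -/

/-- `tableProd` as a bilinear map. -/
def tableProdHom {n : ℕ} (T : Fin n → logLattice lam × logLattice lam) :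
    (logLattice lam → ℂ) →ₗ[ℂ] (logLattice lam → ℂ) →ₗ[ℂ] (logLattice lam → ℂ) :=
  LinearMap.mk₂ ℂ (tableProd T)
    (fun f f' g => by
      ext k; simp [tableProd, add_mul, Finset.sum_add_distrib])
    (fun c f g => by
      ext k; simp [tableProd, Finset.mul_sum, mul_assoc])
    (fun f g g' => by
      ext k; simp [tableProd, mul_add, Finset.sum_add_distrib])
    (fun c f g => by
      ext k; simp [tableProd, Finset.mul_sum, mul_left_comm])

/-- The table consists of triads at unity. -/
def IsTriadTable {n : ℕ} (T : Fin n → logLattice lam × logLattice lam) : Prop :=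
  ∀ j, ((T j).1 : ℝ) + (T j).2 = 1

theorem isTriadTable_dyadic : IsTriadTable (dyadicTable (2 : ℝ)) := by
  intro j
  fin_cases j <;> simp [dyadicTable] <;> norm_num

theorem isTriadTable_trinomial (h : 0 < lam) {a b : ℕ} (hab : 1 = lam ^ b - lam ^ a) :
    IsTriadTable (trinomialTable lam a b) := by
  have ha : lam ^ a ≠ 0 := by positivity
  have hb : lam ^ b ≠ 0 := by positivity
  intro j
  fin_cases j <;> simp [trinomialTable, zpow_sub₀ h.ne'] <;> field_simp <;> linarith

/-- The multiplicity of a pair in a table. -/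
noncomputable def mult {n : ℕ} (T : Fin n → logLattice lam × logLattice lam)
    (x y : logLattice lam) : ℕ :=
  open Classical in (Finset.univ.filter fun j => T j = (x, y)).card

theorem mult_ne_zero {n : ℕ} {T : Fin n → logLattice lam × logLattice lam}
    {x y : logLattice lam} (j : Fin n) (h : T j = (x, y)) : mult T x y ≠ 0 := by
  classical
  exact Finset.card_ne_zero.2 ⟨j, by simp [h]⟩

theorem mult_eq_zero {n : ℕ} {T : Fin n → logLattice lam × logLattice lam}
    {x y : logLattice lam} (h : ∀ j, T j ≠ (x, y)) : mult T x y = 0 := by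
  classical
  simp [mult, h]

/-- Adding `(T j).1 * l = x * k` and `(T j).2 * l = y * k` gives `l = k`, since both pairs sum to
`1`. Counting multiplicity makes repeated table entries harmless. -/
theorem tableProd_delta {n : ℕ} {T : Fin n → logLattice lam × logLattice lam} (h : 0 < lam)
    (hT : IsTriadTable T) {x y : logLattice lam} (hxy : (x : ℝ) + y = 1) (k : logLattice lam) :
    tableProd T (delta (x * k)) (delta (y * k)) = (mult T x y : ℂ) • delta k := by
  classical
  ext l
  have hk := coe_ne_zero h k
  by_cases hl : l = k
  · subst hl
    have hinj : ∀ u v : logLattice lam, u * l = v * l ↔ u = v := fun u v => by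
      simp [Subtype.ext_iff, hk]
    simp only [tableProd, delta, hinj, Pi.smul_apply, mult, Finset.card_filter, Nat.cast_sum,
      smul_eq_mul, if_true, mul_one, ite_mul, one_mul, zero_mul, Prod.ext_iff]
    exact Finset.sum_congr rfl fun j _ => by split_ifs <;> simp_all
  · rw [Pi.smul_apply, delta_of_ne hl, smul_zero]
    refine Finset.sum_eq_zero fun j _ => ?_
    by_cases h1 : (T j).1 * l = x * k
    · by_cases h2 : (T j).2 * l = y * k
      · refine absurd (Subtype.ext ?_) hl
        have e1 := congrArg Subtype.val h1
        have e2 := congrArg Subtype.val h2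
        simp only [coe_mul] at e1 e2
        linear_combination e1 + e2 - (l : ℝ) * hT j + (k : ℝ) * hxy
      · rw [delta_of_ne h2, mul_zero]
    · rw [delta_of_ne h1, zero_mul]

theorem tableProd_delta_eq_zero {n : ℕ} {T : Fin n → logLattice lam × logLattice lam}
    (hT : IsTriadTable T) {p q : logLattice lam} (hpq : (p : ℝ) + q ∉ logLattice lam) :
    tableProd T (delta p) (delta q) = 0 := by
  ext l
  refine Finset.sum_eq_zero fun j _ => ?_
  by_cases h1 : (T j).1 * l = p
  · by_cases h2 : (T j).2 * l = q
    · refine absurd ?_ hpq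
      rw [← h1, ← h2, coe_mul, coe_mul, ← add_mul, hT j, one_mul]
      exact l.2
    · rw [delta_of_ne h2, mul_zero]
  · rw [delta_of_ne h1, zero_mul]

/-- A product built from two tables of triads; all explicit products have this form. -/
def pairProd {n n' : ℕ} (T : Fin n → logLattice lam × logLattice lam)
    (T' : Fin n' → logLattice lam × logLattice lam) (c c' : ℝ) :
    (logLattice lam → ℂ) →ₗ[ℂ] (logLattice lam → ℂ) →ₗ[ℂ] (logLattice lam → ℂ) :=
  (c : ℂ) • tableProdHom T + (c' : ℂ) • tableProdHom T'

theorem pairProd_apply {n n' : ℕ} (T : Fin n → logLattice lam × logLattice lam)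
    (T' : Fin n' → logLattice lam × logLattice lam) (c c' : ℝ) (f g : logLattice lam → ℂ) :
    pairProd T T' c c' f g = c • tableProd T f g + c' • tableProd T' f g := by
  ext k; simp [pairProd, tableProdHom]

/-- The even combination `δ_p + δ_(-p)` and `i` times the odd one satisfy the reality condition. -/
theorem delta_mem_span (p : logLattice lam) :
    delta p ∈ Submodule.span ℂ (latticeFn lam : Set (logLattice lam → ℂ)) := by
  classical
  have hneg : ∀ k : logLattice lam, delta p (-k) = delta (-p) k := fun k => by
    simp only [delta, neg_eq_iff]
  have hneg' : ∀ k : logLattice lam, delta (-p) (-k) = delta p k := fun k => by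
    simp only [delta, neg_eq_iff, LogLattice.neg_neg]
  have hreal : ∀ p k : logLattice lam, starRingEnd ℂ (delta p k) = delta p k := fun p k => by
    simp only [delta]; split_ifs <;> simp
  have hA : delta p + delta (-p) ∈ latticeFn lam :=
    ⟨fun k => by simp [hneg, hneg', hreal, add_comm],
      ((summable_delta p).add (summable_delta (-p))).of_nonneg_of_le (fun _ => norm_nonneg _)
        fun k => norm_add_le _ _⟩
  have hB : Complex.I • (delta p - delta (-p)) ∈ latticeFn lam :=
    ⟨fun k => by simp [hneg, hneg', hreal]; ring,
      ((summable_delta p).add (summable_delta (-p))).of_nonneg_of_le (fun _ => norm_nonneg _)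
        fun k => by simpa using norm_sub_le _ _⟩
  have : delta p = (1 / 2 : ℂ) • (delta p + delta (-p)) +
      (-Complex.I / 2 : ℂ) • (Complex.I • (delta p - delta (-p))) := by
    ext k
    simp only [Pi.add_apply, Pi.smul_apply, Pi.sub_apply, smul_eq_mul]
    linear_combination (delta p k - delta (-p) k) / 2 * Complex.I_mul_I
  rw [this]
  exact Submodule.add_mem _ (Submodule.smul_mem _ _ (Submodule.subset_span hA))
    (Submodule.smul_mem _ _ (Submodule.subset_span hB))

/-- Associativity of a bilinear product extends from a set to its linear span. -/
theorem associative_span {V : Type*} [AddCommGroup V] [Module ℂ V] (m : V →ₗ[ℂ] V →ₗ[ℂ] V)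
    {S : Set V} (h : ∀ f ∈ S, ∀ g ∈ S, ∀ k ∈ S, m (m f g) k = m f (m g k)) {f g k : V}
    (hf : f ∈ Submodule.span ℂ S) (hg : g ∈ Submodule.span ℂ S) (hk : k ∈ Submodule.span ℂ S) :
    m (m f g) k = m f (m g k) := by
  induction hf using Submodule.span_induction with
  | mem f hf =>
    induction hg using Submodule.span_induction with
    | mem g hg =>
      induction hk using Submodule.span_induction with
      | mem k hk => exact h f hf g hg k hk
      | zero => simp
      | add x y _ _ hx hy => simp [hx, hy]
      | smul c x _ hx => simp [hx]
    | zero => simp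
    | add x y _ _ hx hy => simp [hx, hy]
    | smul c x _ hx => simp [hx]
  | zero => simp
  | add x y _ _ hx hy => simp [hx, hy]
  | smul c x _ hx => simp [hx]

theorem notAssociative_of_deltaWitness {a b : ℕ}
    {m : (logLattice lam → ℂ) →ₗ[ℂ] (logLattice lam → ℂ) →ₗ[ℂ] (logLattice lam → ℂ)}
    {op : (logLattice lam → ℂ) → (logLattice lam → ℂ) → logLattice lam → ℂ}
    (hop : ∀ f g, m f g = op f g) (h : DeltaWitness a b op) : NotAssociative op := by
  by_contra hcon
  simp only [NotAssociative, not_exists, not_and, not_not] at hcon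
  refine h.2 ?_
  simp only [← hop] at hcon ⊢
  exact associative_span m (S := latticeFn lam) hcon (delta_mem_span _) (delta_mem_span _)
    (delta_mem_span _)

theorem deltaWitness_pairProd (hlam : 1 < lam) {n n' : ℕ}
    {T : Fin n → logLattice lam × logLattice lam} {T' : Fin n' → logLattice lam × logLattice lam}
    (hT : IsTriadTable T) (hT' : IsTriadTable T') {c c' : ℝ} {a b : ℕ}
    (hab : 1 = lam ^ b - lam ^ a)
    (hc : c * mult T (pt lam b) (-pt lam a) + c' * mult T' (pt lam b) (-pt lam a) ≠ 0) :
    DeltaWitness a b fun f g => pairProd T T' c c' f g := by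
  have h : 0 < lam := by linarith
  have hb := one_add_pow_notMem hlam hab
  have htriad : ((pt lam b : logLattice lam) : ℝ) + (-pt lam a : logLattice lam) = 1 := by
    simp; linarith
  -- The cases `k = 1` and `k = lam ^ b` are the two products of the obstruction lemma, with the
  -- same coefficient.
  have hprod : ∀ k : logLattice lam,
      pairProd T T' c c' (delta (pt lam b * k)) (delta (-pt lam a * k)) =
        ((c * mult T (pt lam b) (-pt lam a) + c' * mult T' (pt lam b) (-pt lam a) : ℝ) : ℂ) •
          delta k := fun k => by
    rw [pairProd_apply, tableProd_delta h hT htriad, tableProd_delta h hT' htriad]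
    ext l
    simp [add_mul, mul_assoc]
  refine ⟨hb, not_associative_of_triad h (fun f g => pairProd T T' c c' f g) delta
    (Complex.ofReal_ne_zero.2 hc) (fun h0 => ?_) (fun z f g => by simp) (fun f => by simp)
    ?_ ?_ (fun p q hpq => ?_) hb⟩
  · have := congrFun h0 (pt lam 0)
    rw [delta_self] at this
    exact one_ne_zero this
  · convert hprod (pt lam 0) using 3 <;> congr 1 <;> exact Subtype.ext (by simp)
  · convert hprod (pt lam b) using 3 <;> congr 1 <;> apply Subtype.ext
    · simp [two_mul, zpow_add₀ h.ne']
    · simp [zpow_add₀ h.ne']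
  · simp only [pairProd_apply, tableProd_delta_eq_zero hT hpq, tableProd_delta_eq_zero hT' hpq,
      smul_zero, add_zero]

/-! ### The explicit products. -/

theorem pt_injective (hlam : 1 < lam) : Function.Injective (pt lam) := fun m n h =>
  zpow_right_injective₀ (by linarith) hlam.ne' (congrArg Subtype.val h)

theorem pt_ne_neg_pt (h : 0 < lam) (m n : ℤ) : pt lam m ≠ -pt lam n := fun h' => by
  have := congrArg Subtype.val h'
  simp only [coe_neg, coe_pt] at this
  linarith [zpow_pos h m, zpow_pos h n]

theorem neg_pt_ne_pt (h : 0 < lam) (m n : ℤ) : -pt lam m ≠ pt lam n :=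
  (pt_ne_neg_pt h n m).symm

theorem prodDyadic_witness {c : ℝ} (hc : c ≠ 0) :
    NotAssociative (prodDyadic 2 c) ∧ DeltaWitness 0 1 (prodDyadic 2 c) := by
  -- The second table is a dummy with weight `0`.
  have heq : ∀ f g, pairProd (dyadicTable 2) (dyadicTable 2) c 0 f g = prodDyadic 2 c f g :=
    fun f g => by rw [pairProd_apply, zero_smul, add_zero]; rfl
  have hw : DeltaWitness 0 1 (prodDyadic 2 c) := by
    have := deltaWitness_pairProd (lam := 2) (by norm_num) isTriadTable_dyadic
      isTriadTable_dyadic (c := c) (c' := 0) (a := 0) (b := 1) (by norm_num)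
      (by simpa [hc] using mult_ne_zero (T := dyadicTable 2) 0 (by simp [dyadicTable]))
    simpa only [heq] using this
  exact ⟨notAssociative_of_deltaWitness heq hw, hw⟩

theorem prodTrinomial_witness (hlam : 1 < lam) {a b : ℕ} (hab : 1 = lam ^ b - lam ^ a) {c : ℝ}
    (hc : c ≠ 0) :
    NotAssociative (prodTrinomial lam a b c) ∧ DeltaWitness a b (prodTrinomial lam a b c) := by
  have hT := isTriadTable_trinomial (by linarith) hab
  have heq : ∀ f g, pairProd (trinomialTable lam a b) (trinomialTable lam a b) c 0 f g =
      prodTrinomial lam a b c f g :=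
    fun f g => by rw [pairProd_apply, zero_smul, add_zero]; rfl
  have hw : DeltaWitness a b (prodTrinomial lam a b c) := by
    have := deltaWitness_pairProd hlam hT hT (c := c) (c' := 0) hab
      (by simpa [hc] using mult_ne_zero (T := trinomialTable lam a b) 0 rfl)
    simpa only [heq] using this
  exact ⟨notAssociative_of_deltaWitness heq hw, hw⟩

theorem prodPlastic_witness (hlam : 1 < lam) (h3 : lam ^ 3 = lam + 1) {c₁ c₂ : ℝ}
    (hc : c₁ ≠ 0 ∨ c₂ ≠ 0) :
    NotAssociative (prodPlastic lam c₁ c₂) ∧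
      (c₁ ≠ 0 → DeltaWitness 1 3 (prodPlastic lam c₁ c₂)) ∧
      (c₂ ≠ 0 → DeltaWitness 4 5 (prodPlastic lam c₁ c₂)) := by
  have h0 : 0 < lam := by linarith
  have h13 : 1 = lam ^ 3 - lam ^ 1 := by linarith
  -- Factorization `X ^ 5 - X ^ 4 - 1 = (X ^ 3 - X - 1) * (X ^ 2 - X + 1)`.
  have h45 : 1 = lam ^ 5 - lam ^ 4 := by linear_combination (-(lam ^ 2 - lam + 1)) * h3
  have hT := isTriadTable_trinomial h0 h13
  have hT' := isTriadTable_trinomial h0 h45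
  have heq : ∀ f g, pairProd (trinomialTable lam (1 : ℕ) (3 : ℕ))
      (trinomialTable lam (4 : ℕ) (5 : ℕ)) c₁ c₂ f g = prodPlastic lam c₁ c₂ f g :=
    fun f g => by rw [pairProd_apply]; rfl
  -- The pair `(lam ^ 3, -lam)` does not occur in the other table, so `c₂` cannot cancel the
  -- contribution of `c₁`.
  have hw1 : c₁ ≠ 0 → DeltaWitness 1 3 (prodPlastic lam c₁ c₂) := fun hc => by
    have := deltaWitness_pairProd hlam hT hT' (c := c₁) (c' := c₂) h13 (by
      rw [mult_eq_zero (T := trinomialTable lam (4 : ℕ) (5 : ℕ)) (fun j => by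
        fin_cases j <;> simp [trinomialTable, (pt_injective hlam).eq_iff, pt_ne_neg_pt h0,
          neg_pt_ne_pt h0])]
      simpa [hc] using mult_ne_zero (T := trinomialTable lam (1 : ℕ) (3 : ℕ)) 0 rfl)
    simpa only [heq] using this
  have hw2 : c₂ ≠ 0 → DeltaWitness 4 5 (prodPlastic lam c₁ c₂) := fun hc => by
    have := deltaWitness_pairProd hlam hT hT' (c := c₁) (c' := c₂) h45 (by
      rw [mult_eq_zero (T := trinomialTable lam (1 : ℕ) (3 : ℕ)) (fun j => by
        fin_cases j <;> simp [trinomialTable, (pt_injective hlam).eq_iff, pt_ne_neg_pt h0,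
          neg_pt_ne_pt h0])]
      simpa [hc] using mult_ne_zero (T := trinomialTable lam (4 : ℕ) (5 : ℕ)) 0 rfl)
    simpa only [heq] using this
  refine ⟨?_, hw1, hw2⟩
  rcases hc with hc | hc
  · exact notAssociative_of_deltaWitness heq (hw1 hc)
  · exact notAssociative_of_deltaWitness heq (hw2 hc)

/-! ### Complex summable functions and the complexified product. -/

/-- The complex vector space of absolutely summable functions on the lattice. -/
def summableFn (lam : ℝ) : Submodule ℂ (logLattice lam → ℂ) where
  carrier := {f | Summable fun k => ‖f k‖}
  zero_mem' := by simp
  add_mem' := fun {f g} hf hg =>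
    (Summable.add hf hg).of_nonneg_of_le (fun _ => norm_nonneg _) fun k => norm_add_le (f k) (g k)
  smul_mem' := fun c f hf => by
    simpa [norm_smul] using Summable.mul_left ‖c‖ hf

theorem neg_involutive : Function.Involutive fun k : logLattice lam => -k :=
  LogLattice.neg_neg

/-- The conjugation `k ↦ conj (f (-k))`, whose fixed points are the elements of `latticeFn`. -/
def conjFn (f : summableFn lam) : summableFn lam :=
  ⟨fun k => starRingEnd ℂ (f.1 (-k)), by
    have : Summable fun k => ‖f.1 k‖ := f.2
    have h2 := this.comp_injective (neg_involutive (lam := lam)).injective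
    change Summable _
    simpa [Function.comp_def] using h2⟩

/-- The combination `u + i v`. -/
noncomputable def ofParts (u v : latticeFn lam) : summableFn lam :=
  ⟨fun k => u.1 k + Complex.I * v.1 k, by
    change Summable _
    refine (u.2.2.add v.2.2).of_nonneg_of_le (fun _ => norm_nonneg _) fun k => ?_
    simpa using norm_add_le (u.1 k) (Complex.I * v.1 k)⟩

/-- The component `u ∈ latticeFn` of `f = u + i v`. -/
noncomputable def rePart (f : summableFn lam) : latticeFn lam :=
  ⟨fun k => (f.1 k + (conjFn f).1 k) / 2, fun k => by
      simp [conjFn, LogLattice.neg_neg, add_comm, map_ofNat], by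
    refine ((f + conjFn f).2.mul_left (1 / 2)).congr fun k => ?_
    simp; ring⟩

/-- The component `v ∈ latticeFn` of `f = u + i v`. -/
noncomputable def imPart (f : summableFn lam) : latticeFn lam :=
  ⟨fun k => -Complex.I * (f.1 k - (conjFn f).1 k) / 2, fun k => by
      simp [conjFn, LogLattice.neg_neg, map_ofNat]; ring, by
    refine ((f - conjFn f).2.mul_left (1 / 2)).congr fun k => ?_
    simp; ring⟩

theorem ofParts_re_im (f : summableFn lam) : ofParts (rePart f) (imPart f) = f := by
  ext k
  simp only [ofParts, rePart, imPart]
  linear_combination (-(f.1 k - (conjFn f).1 k) / 2) * Complex.I_mul_I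

theorem rePart_ofParts (u v : latticeFn lam) : rePart (ofParts u v) = u := by
  ext k
  simp [rePart, ofParts, conjFn, u.2.1, v.2.1]
  ring

theorem imPart_ofParts (u v : latticeFn lam) : imPart (ofParts u v) = v := by
  ext k
  simp only [imPart, ofParts, conjFn, u.2.1, v.2.1, map_add, map_mul, Complex.conj_I,
    Complex.conj_conj]
  linear_combination (-v.1 k) * Complex.I_mul_I

theorem smul_ofParts (c : ℂ) (u v : latticeFn lam) :
    c • ofParts u v = ofParts (c.re • u - c.im • v) (c.im • u + c.re • v) := by
  ext k
  simp only [ofParts, Submodule.coe_smul, Submodule.coe_add, Submodule.coe_sub, Pi.smul_apply,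
    Pi.add_apply, Pi.sub_apply, Complex.real_smul, smul_eq_mul]
  conv_lhs => rw [← Complex.re_add_im c]
  linear_combination (c.im * v.1 k) * Complex.I_mul_I

theorem rePart_smul (c : ℂ) (f : summableFn lam) :
    rePart (c • f) = c.re • rePart f - c.im • imPart f := by
  conv_lhs => rw [← ofParts_re_im f, smul_ofParts, rePart_ofParts]

theorem imPart_smul (c : ℂ) (f : summableFn lam) :
    imPart (c • f) = c.im • rePart f + c.re • imPart f := by
  conv_lhs => rw [← ofParts_re_im f, smul_ofParts, imPart_ofParts]

theorem rePart_conjFn (f : summableFn lam) : rePart (conjFn f) = rePart f := by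
  ext k
  simp [rePart, conjFn, LogLattice.neg_neg, add_comm]

theorem imPart_conjFn (f : summableFn lam) : imPart (conjFn f) = -imPart f := by
  ext k
  simp [imPart, conjFn, LogLattice.neg_neg]
  ring

/-- `delta p` as a summable function. -/
noncomputable def single (p : logLattice lam) : summableFn lam := ⟨delta p, summable_delta p⟩

theorem conjFn_single (p : logLattice lam) : conjFn (single p) = single (-p) := by
  classical
  ext k
  simp only [conjFn, single, delta, neg_eq_iff]
  split_ifs <;> simp

theorem summable_mul_conj {f g : logLattice lam → ℂ} (hf : Summable fun k => ‖f k‖)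
    (hg : Summable fun k => ‖g k‖) : Summable fun k => f k * starRingEnd ℂ (g k) := by
  have hg' : Summable fun k => ‖starRingEnd ℂ (g k)‖ := by simpa using hg
  exact (summable_mul_of_summable_norm hf hg').comp_injective
    (i := fun k => (k, k)) fun _ _ h => congrArg Prod.fst h

theorem innerProd_single (f : summableFn lam) (p : logLattice lam) :
    innerProd f.1 (single p).1 = f.1 p := by
  rw [innerProd, tsum_eq_single p fun k hk => by simp [single, delta_of_ne hk]]
  simp [single, delta_self]

theorem innerProd_single_left (f : summableFn lam) (p : logLattice lam) :
    innerProd (single p).1 f.1 = starRingEnd ℂ (f.1 p) := by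
  rw [innerProd, tsum_eq_single p fun k hk => by simp [single, delta_of_ne hk]]
  simp [single, delta_self]

theorem innerProd_add_left (f g h : latticeFn lam) :
    innerProd (f + g).1 h.1 = innerProd f.1 h.1 + innerProd g.1 h.1 := by
  unfold innerProd
  rw [← (summable_mul_conj f.2.2 h.2.2).tsum_add (summable_mul_conj g.2.2 h.2.2)]
  simp [add_mul]

theorem innerProd_sub_left (f g h : latticeFn lam) :
    innerProd (f - g).1 h.1 = innerProd f.1 h.1 - innerProd g.1 h.1 := by
  unfold innerProd
  rw [← (summable_mul_conj f.2.2 h.2.2).tsum_sub (summable_mul_conj g.2.2 h.2.2)]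
  simp [sub_mul]

theorem innerProd_add_right (f g h : latticeFn lam) :
    innerProd f.1 (g + h).1 = innerProd f.1 g.1 + innerProd f.1 h.1 := by
  unfold innerProd
  rw [← (summable_mul_conj f.2.2 g.2.2).tsum_add (summable_mul_conj f.2.2 h.2.2)]
  simp [mul_add]

theorem innerProd_sub_right (f g h : latticeFn lam) :
    innerProd f.1 (g - h).1 = innerProd f.1 g.1 - innerProd f.1 h.1 := by
  unfold innerProd
  rw [← (summable_mul_conj f.2.2 g.2.2).tsum_sub (summable_mul_conj f.2.2 h.2.2)]
  simp [mul_sub]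

theorem innerProd_ofParts (u v u' v' : latticeFn lam) :
    innerProd (ofParts u v).1 (ofParts u' v').1 =
      innerProd u.1 u'.1 + innerProd v.1 v'.1 +
        Complex.I * (innerProd v.1 u'.1 - innerProd u.1 v'.1) := by
  have h1 := summable_mul_conj u.2.2 u'.2.2
  have h2 := summable_mul_conj v.2.2 v'.2.2
  have h3 := summable_mul_conj v.2.2 u'.2.2
  have h4 := summable_mul_conj u.2.2 v'.2.2
  unfold innerProd
  rw [← h1.tsum_add h2, ← h3.tsum_sub h4, ← tsum_mul_left,
    ← (h1.add h2).tsum_add ((h3.sub h4).mul_left _)]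
  congr 1
  ext k
  simp only [ofParts, map_add, map_mul, Complex.conj_I]
  linear_combination (-(v.1 k * starRingEnd ℂ (v'.1 k))) * Complex.I_mul_I

section Complexification

variable {op : latticeFn lam → latticeFn lam → latticeFn lam} (hop : IsSymmetricProduct op)

/-- A symmetric product as a real bilinear map. -/
noncomputable def bilinOp : latticeFn lam →ₗ[ℝ] latticeFn lam →ₗ[ℝ] latticeFn lam :=
  have hadd : ∀ f g h, op (f + g) h = op f h + op g h := fun f g h => by
    simpa using hop.bilinear f g h 1
  have hzero : ∀ h, op 0 h = 0 := fun h => by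
    simpa using hadd 0 0 h
  have hsmul : ∀ (c : ℝ) f h, op (c • f) h = c • op f h := fun c f h => by
    simpa [hzero] using hop.bilinear 0 f h c
  LinearMap.mk₂ ℝ op hadd hsmul
    (fun f g h => by rw [hop.comm, hadd, hop.comm g, hop.comm h])
    (fun c f g => by rw [hop.comm, hsmul, hop.comm g])

theorem bilinOp_apply (f g : latticeFn lam) : bilinOp hop f g = op f g := rfl

/-- The complex bilinear extension of a symmetric product. -/
noncomputable def complexOp (f g : summableFn lam) : summableFn lam :=
  ofParts (bilinOp hop (rePart f) (rePart g) - bilinOp hop (imPart f) (imPart g))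
    (bilinOp hop (rePart f) (imPart g) + bilinOp hop (imPart f) (rePart g))

theorem complexOp_comm (f g : summableFn lam) : complexOp hop f g = complexOp hop g f := by
  have hc : ∀ u v, bilinOp hop u v = bilinOp hop v u := hop.comm
  unfold complexOp
  rw [hc (rePart f) (rePart g), hc (imPart f) (imPart g), hc (rePart f) (imPart g),
    hc (imPart f) (rePart g), add_comm (bilinOp hop (imPart g) (rePart f))]

theorem complexOp_smul_left (c : ℂ) (f g : summableFn lam) :
    complexOp hop (c • f) g = c • complexOp hop f g := by
  unfold complexOp
  rw [smul_ofParts]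
  simp only [rePart_smul, imPart_smul, map_add, map_sub, map_smul, LinearMap.add_apply,
    LinearMap.sub_apply, LinearMap.smul_apply]
  congr 1 <;> module

theorem complexOp_smul_right (c : ℂ) (f g : summableFn lam) :
    complexOp hop f (c • g) = c • complexOp hop f g := by
  rw [complexOp_comm, complexOp_smul_left, complexOp_comm]

theorem complexOp_zero_right (f : summableFn lam) : complexOp hop f 0 = 0 := by
  simpa using complexOp_smul_right hop 0 f 0

theorem complexOp_assoc (h : ∀ f g h, op (op f g) h = op f (op g h)) (f g k : summableFn lam) :
    complexOp hop (complexOp hop f g) k = complexOp hop f (complexOp hop g k) := by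
  have h' : ∀ f g k, bilinOp hop (bilinOp hop f g) k = bilinOp hop f (bilinOp hop g k) := h
  simp only [complexOp, rePart_ofParts, imPart_ofParts, map_add, map_sub, LinearMap.add_apply,
    LinearMap.sub_apply, h']
  congr 1 <;> abel

/-- The inner product is conjugate-linear in its second slot while the product is bilinear, so
moving `g` across replaces it by `conjFn g`. -/
theorem innerProd_complexOp (f g h : summableFn lam) :
    innerProd (complexOp hop f g).1 h.1 = innerProd f.1 (complexOp hop (conjFn g) h).1 := by
  have ha : ∀ u v w : latticeFn lam, innerProd (bilinOp hop u v).1 w.1 =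
    innerProd u.1 (bilinOp hop v w).1 := hop.assoc_avg
  conv_lhs => rw [← ofParts_re_im h]
  conv_rhs => rw [← ofParts_re_im f]
  unfold complexOp
  simp only [innerProd_ofParts, rePart_conjFn, imPart_conjFn, map_neg, LinearMap.neg_apply,
    sub_neg_eq_add, ← sub_eq_add_neg, innerProd_add_left, innerProd_sub_left,
    innerProd_add_right, innerProd_sub_right, ha]
  ring

theorem complexOp_leibniz {f g f' g' : summableFn lam} (hf : f'.1 = partialD f.1)
    (hg : g'.1 = partialD g.1) :
    partialD (complexOp hop f g).1 = (complexOp hop f' g).1 + (complexOp hop f g').1 := by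
  -- The symbol `i k` is fixed by `k ↦ -k` followed by conjugation, so `partialD` acts on the two
  -- components separately.
  have hre : ∀ {f f' : summableFn lam}, f'.1 = partialD f.1 →
      (rePart f').1 = partialD (rePart f).1 := fun {f f'} h => by
    ext k
    simp [rePart, conjFn, h, partialD]; ring
  have him : ∀ {f f' : summableFn lam}, f'.1 = partialD f.1 →
      (imPart f').1 = partialD (imPart f).1 := fun {f f'} h => by
    ext k
    simp [imPart, conjFn, h, partialD]; ring
  ext k
  have h1 := congrFun (hop.leibniz _ _ _ _ (hre hf) (hre hg)) k
  have h2 := congrFun (hop.leibniz _ _ _ _ (him hf) (him hg)) k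
  have h3 := congrFun (hop.leibniz _ _ _ _ (hre hf) (him hg)) k
  have h4 := congrFun (hop.leibniz _ _ _ _ (him hf) (hre hg)) k
  simp only [complexOp, ofParts, partialD, bilinOp_apply, Submodule.coe_add, Submodule.coe_sub,
    Pi.add_apply, Pi.sub_apply] at h1 h2 h3 h4 ⊢
  linear_combination h1 - h2 + Complex.I * (h3 + h4)

theorem complexOp_rescale {f g f' g' : summableFn lam} (hf : f'.1 = rescale f.1)
    (hg : g'.1 = rescale g.1) :
    rescale (complexOp hop f g).1 = (complexOp hop f' g').1 := by
  have hneg : ∀ k : logLattice lam, pt lam 1 * -k = -(pt lam 1 * k) := fun k =>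
    Subtype.ext (by simp)
  have hre : ∀ {f f' : summableFn lam}, f'.1 = rescale f.1 →
      (rePart f').1 = rescale (rePart f).1 := fun {f f'} h => by
    ext k
    simp [rePart, conjFn, h, rescale, hneg]
  have him : ∀ {f f' : summableFn lam}, f'.1 = rescale f.1 →
      (imPart f').1 = rescale (imPart f).1 := fun {f f'} h => by
    ext k
    simp [imPart, conjFn, h, rescale, hneg]
  ext k
  have h1 := congrFun (hop.scaling _ _ _ _ (hre hf) (hre hg)) k
  have h2 := congrFun (hop.scaling _ _ _ _ (him hf) (him hg)) k
  have h3 := congrFun (hop.scaling _ _ _ _ (hre hf) (him hg)) k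
  have h4 := congrFun (hop.scaling _ _ _ _ (him hf) (hre hg)) k
  simp only [complexOp, ofParts, rescale, bilinOp_apply, Submodule.coe_add, Submodule.coe_sub,
    Pi.add_apply, Pi.sub_apply] at h1 h2 h3 h4 ⊢
  linear_combination h1 - h2 + Complex.I * (h3 + h4)

theorem complexOp_reflect {f g f' g' : summableFn lam} (hf : f'.1 = reflect f.1)
    (hg : g'.1 = reflect g.1) :
    reflect (complexOp hop f g).1 = (complexOp hop f' g').1 := by
  have hre : ∀ {f f' : summableFn lam}, f'.1 = reflect f.1 →
      (rePart f').1 = reflect (rePart f).1 := fun {f f'} h => by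
    ext k
    simp [rePart, conjFn, h, reflect]
  have him : ∀ {f f' : summableFn lam}, f'.1 = reflect f.1 →
      (imPart f').1 = reflect (imPart f).1 := fun {f f'} h => by
    ext k
    simp [imPart, conjFn, h, reflect]
  ext k
  have h1 := congrFun (hop.parity _ _ _ _ (hre hf) (hre hg)) k
  have h2 := congrFun (hop.parity _ _ _ _ (him hf) (him hg)) k
  have h3 := congrFun (hop.parity _ _ _ _ (hre hf) (him hg)) k
  have h4 := congrFun (hop.parity _ _ _ _ (him hf) (hre hg)) k
  simp only [complexOp, ofParts, reflect, bilinOp_apply, Submodule.coe_add, Submodule.coe_sub,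
    Pi.add_apply, Pi.sub_apply] at h1 h2 h3 h4 ⊢
  linear_combination h1 - h2 + Complex.I * (h3 + h4)

/-! ### Structure constants and their symmetries. -/

/-- The structure constants of the product. -/
noncomputable def structConst (p q k : logLattice lam) : ℂ :=
  (complexOp hop (single p) (single q)).1 k

/-- Delta functions are eigenvectors of `partialD`, so the Leibniz rule reads `i * (k - p - q) *
structConst hop p q k = 0`. -/
theorem structConst_eq_zero {p q k : logLattice lam} (h : (k : ℝ) ≠ p + q) :
    structConst hop p q k = 0 := by
  have hd : ∀ p : logLattice lam,
      ((Complex.I * ((p : ℝ) : ℂ)) • single p).1 = partialD (single p).1 := fun p => by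
    ext l
    by_cases hl : l = p
    · simp [single, partialD, hl]
    · simp [single, partialD, delta_of_ne hl]
  have h1 := congrFun (complexOp_leibniz hop (hd p) (hd q)) k
  rw [complexOp_smul_left, complexOp_smul_right] at h1
  simp only [partialD, Pi.add_apply, Submodule.coe_smul, Pi.smul_apply, smul_eq_mul] at h1
  have h2 : (((k : ℝ) - (p + q) : ℝ) : ℂ) * structConst hop p q k = 0 := by
    apply mul_left_cancel₀ Complex.I_ne_zero
    push_cast
    unfold structConst
    linear_combination h1
  exact (mul_eq_zero.1 h2).resolve_left (Complex.ofReal_ne_zero.2 (sub_ne_zero.2 h))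

theorem complexOp_single {p q k : logLattice lam} (h : (k : ℝ) = p + q) :
    complexOp hop (single p) (single q) = structConst hop p q k • single k := by
  ext l
  by_cases hl : l = k
  · simp [hl, single, delta_self, structConst]
  · have : (l : ℝ) ≠ p + q := fun h' => hl (Subtype.ext (h'.trans h.symm))
    simpa [single, delta_of_ne hl, structConst] using structConst_eq_zero hop this

theorem complexOp_single_eq_zero {p q : logLattice lam} (h : (p : ℝ) + q ∉ logLattice lam) :
    complexOp hop (single p) (single q) = 0 := by
  ext l
  exact structConst_eq_zero hop fun h' => h (h' ▸ l.2)

theorem structConst_comm (p q k : logLattice lam) :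
    structConst hop p q k = structConst hop q p k := by
  rw [structConst, complexOp_comm, structConst]

theorem structConst_adjoint (p q k : logLattice lam) :
    structConst hop p q k = starRingEnd ℂ (structConst hop (-q) k p) := by
  rw [structConst, ← innerProd_single, innerProd_complexOp, conjFn_single,
    innerProd_single_left, structConst]

theorem structConst_neg (p q k : logLattice lam) :
    structConst hop (-p) (-q) (-k) = structConst hop p q k := by
  classical
  have hr : ∀ p : logLattice lam, (single p).1 = reflect (single (-p)).1 := fun p => by
    ext l
    simp [single, reflect, delta, neg_eq_iff, LogLattice.neg_neg]
  exact congrFun (complexOp_reflect hop (hr p) (hr q)) k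

theorem structConst_scale (h : 0 < lam) (n : ℤ) (p q k : logLattice lam) :
    structConst hop (pt lam n * p) (pt lam n * q) (pt lam n * k) = structConst hop p q k := by
  classical
  have hr : ∀ p : logLattice lam, (single p).1 = rescale (single (pt lam 1 * p)).1 := fun p => by
    ext l
    simp [single, rescale, delta, Subtype.ext_iff, h.ne']
  have hstep : ∀ (n : ℤ) (p : logLattice lam), pt lam (n + 1) * p = pt lam 1 * (pt lam n * p) :=
    fun n p => Subtype.ext (by simp [zpow_add₀ h.ne']; ring)
  have hone : ∀ n : ℤ, structConst hop (pt lam (n + 1) * p) (pt lam (n + 1) * q)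
      (pt lam (n + 1) * k) = structConst hop (pt lam n * p) (pt lam n * q) (pt lam n * k) :=
    fun n => by
      rw [hstep, hstep, hstep]
      exact congrFun (complexOp_rescale hop (hr (pt lam n * p)) (hr (pt lam n * q))) (pt lam n * k)
  induction n using Int.induction_on with
  | zero =>
    have : ∀ p : logLattice lam, pt lam 0 * p = p := fun p => Subtype.ext (by simp)
    rw [this, this, this]
  | succ n ih => rw [hone, ih]
  | pred n ih => rw [← ih, ← hone, sub_add_cancel]

/-! ### Active triads and their normal form. -/

/-- Nonvanishing of the product on a triad `x + y + z = 0`. -/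
def ActiveTriad (x y z : logLattice lam) : Prop := structConst hop x y (-z) ≠ 0

variable {hop} {x y z : logLattice lam}

theorem ActiveTriad.sum_eq_zero (h : ActiveTriad hop x y z) : (x : ℝ) + y + z = 0 := by
  by_contra hne
  exact h (structConst_eq_zero hop fun h' => hne (by rw [coe_neg] at h'; linarith))

theorem ActiveTriad.swap (h : ActiveTriad hop x y z) : ActiveTriad hop y x z := by
  rwa [ActiveTriad, structConst_comm]

/-- Adjointness turns the constant into the conjugate of the one for `(-y, -z, x)`, and parity flips
all signs. With `swap` this yields all permutations. -/
theorem ActiveTriad.rotate (h : ActiveTriad hop x y z) : ActiveTriad hop y z x := by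
  rw [ActiveTriad, structConst_adjoint, ne_eq, map_eq_zero] at h
  rwa [ActiveTriad, ← structConst_neg, LogLattice.neg_neg]

theorem ActiveTriad.neg (h : ActiveTriad hop x y z) : ActiveTriad hop (-x) (-y) (-z) := by
  rwa [ActiveTriad, structConst_neg]

theorem ActiveTriad.scale (hlam : 0 < lam) (n : ℤ) (h : ActiveTriad hop x y z) :
    ActiveTriad hop (pt lam n * x) (pt lam n * y) (pt lam n * z) := by
  have : -(pt lam n * z) = pt lam n * -z := Subtype.ext (by simp)
  rwa [ActiveTriad, this, structConst_scale hop hlam]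

theorem ActiveTriad.normalize (hlam : 1 < lam) {l m n : ℤ}
    (h : ActiveTriad hop (pt lam l) (-pt lam m) (-pt lam n)) :
    ∃ a b : ℕ, ActiveTriad hop (pt lam b) (-pt lam a) (-pt lam 0) := by
  have h0 : 0 < lam := by linarith
  -- Dividing by the smaller of the two negative terms, in absolute value, makes that term `-1` and
  -- the other exponents nonnegative.
  wlog hmn : n ≤ m generalizing m n
  · exact this h.swap.rotate (le_of_not_ge hmn)
  have hs := h.sum_eq_zero
  simp only [coe_neg, coe_pt] at hs
  have hl : m < l := (zpow_lt_zpow_iff_right₀ hlam).1 (by linarith [zpow_pos h0 n])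
  obtain ⟨a, ha⟩ := Int.eq_ofNat_of_zero_le (sub_nonneg.2 hmn)
  obtain ⟨b, hb⟩ := Int.eq_ofNat_of_zero_le (sub_nonneg.2 (hmn.trans hl.le))
  refine ⟨a, b, ?_⟩
  have hmul : ∀ i : ℤ, pt lam (-n) * pt lam i = pt lam (i - n) := fun i => by
    rw [← pt_add h0.ne', neg_add_eq_sub]
  have hneg : ∀ i : ℤ, pt lam (-n) * -pt lam i = -pt lam (i - n) := fun i => by
    rw [← hmul]; exact Subtype.ext (by simp)
  have := h.scale h0 (-n)
  rwa [hmul, hneg, hneg, sub_self, ha, hb] at this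

/-- Three terms with sum zero cannot share a sign; negation and rotation bring them to one positive
and two negative terms. -/
theorem ActiveTriad.exists_normalized (hlam : 1 < lam) (h : ActiveTriad hop x y z) :
    ∃ a b : ℕ, ActiveTriad hop (pt lam b) (-pt lam a) (-pt lam 0) := by
  have h0 : 0 < lam := by linarith
  have hs := h.sum_eq_zero
  have hcases : ∀ x : logLattice lam, ∃ n, x = pt lam n ∨ x = -pt lam n := by
    rintro ⟨x, n, rfl | rfl⟩
    exacts [⟨n, Or.inl rfl⟩, ⟨n, Or.inr rfl⟩]
  obtain ⟨l, rfl | rfl⟩ := hcases x <;> obtain ⟨m, rfl | rfl⟩ := hcases y <;>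
    obtain ⟨n, rfl | rfl⟩ := hcases z <;> simp only [coe_neg, coe_pt] at hs
  · linarith [zpow_pos h0 l, zpow_pos h0 m, zpow_pos h0 n]
  · have := h.neg.rotate.rotate
    rw [LogLattice.neg_neg] at this
    exact this.normalize hlam
  · have := h.neg.rotate
    rw [LogLattice.neg_neg] at this
    exact this.normalize hlam
  · exact h.normalize hlam
  · have := h.neg
    rw [LogLattice.neg_neg] at this
    exact this.normalize hlam
  · exact h.rotate.normalize hlam
  · exact h.rotate.rotate.normalize hlam
  · linarith [zpow_pos h0 l, zpow_pos h0 m, zpow_pos h0 n]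

/-! ### A nonzero product has an active triad; conclusion. -/

variable (hop)

/-- By adjointness the value of `f * g` at `k` is the inner product of `f` with `conjFn g * δ_k`.
This tests on delta functions without any continuity of the product; a second use replaces the other
factor too. -/
theorem exists_complexOp_single_ne_zero {f g : summableFn lam} (h : complexOp hop f g ≠ 0) :
    ∃ k, complexOp hop (single k) (conjFn g) ≠ 0 := by
  by_contra! hcon
  refine h ?_
  ext k
  have := innerProd_complexOp hop f g (single k)
  rw [innerProd_single, complexOp_comm hop (conjFn g), hcon] at this
  simpa [innerProd] using this

theorem exists_activeTriad (h : ∃ f g, op f g ≠ 0) : ∃ x y z, ActiveTriad hop x y z := by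
  obtain ⟨f, g, hfg⟩ := h
  have h1 : complexOp hop (ofParts f 0) (ofParts g 0) ≠ 0 := fun h0 => hfg <| by
    have := congrArg rePart h0
    have hz : rePart (0 : summableFn lam) = 0 := by ext k; simp [rePart, conjFn]
    simpa [complexOp, rePart_ofParts, imPart_ofParts, hz, bilinOp_apply] using this
  obtain ⟨k, hk⟩ := exists_complexOp_single_ne_zero hop h1
  rw [complexOp_comm] at hk
  obtain ⟨p, hp⟩ := exists_complexOp_single_ne_zero hop hk
  rw [conjFn_single] at hp
  by_contra! hcon
  refine hp ?_
  ext l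
  have := hcon p (-k) (-l)
  rwa [ActiveTriad, not_not, LogLattice.neg_neg] at this

theorem IsSymmetricProduct.exists_not_associative (hop : IsSymmetricProduct op) (hlam : 1 < lam)
    (hne : ∃ f g, op f g ≠ 0) :
    ∃ f g h, op (op f g) h ≠ op f (op g h) := by
  have h0 : 0 < lam := by linarith
  obtain ⟨x, y, z, hxyz⟩ := exists_activeTriad hop hne
  obtain ⟨a, b, hact⟩ := hxyz.exists_normalized hlam
  have hsum := hact.sum_eq_zero
  simp only [coe_neg, coe_pt, zpow_natCast, zpow_zero] at hsum
  have hab : 1 = lam ^ b - lam ^ a := by linarith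
  have hb := one_add_pow_notMem hlam hab
  by_contra! hassoc
  rw [ActiveTriad, LogLattice.neg_neg] at hact
  refine not_associative_of_triad h0 (complexOp hop) single hact (fun h => ?_)
    (complexOp_smul_left hop) (complexOp_zero_right hop) (complexOp_single hop ?_) ?_
    (fun p q => complexOp_single_eq_zero hop) hb (complexOp_assoc hop hassoc _ _ _)
  · have := congrFun (congrArg Subtype.val h) (pt lam 0)
    simp [single, delta_self] at this
  · simp; linarith
  · rw [← structConst_scale hop h0 b]
    have e1 : pt lam (2 * b) = pt lam b * pt lam b := by rw [two_mul, pt_add h0.ne']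
    have e2 : -pt lam (a + b) = pt lam b * -pt lam a :=
      Subtype.ext (by simp [zpow_add₀ h0.ne', mul_comm])
    have e3 : pt lam b * pt lam 0 = pt lam b := Subtype.ext (by simp)
    rw [e1, e2, e3]
    refine complexOp_single hop ?_
    simp
    linear_combination lam ^ b * hab

end Complexification

end LogLattice

theorem corollary1 (lam : ℝ) (hlam : 1 < lam) :
    ((lam = 2 ∨ lam = LogLattice.plastic ∨ ∃ a b : ℕ, LogLattice.IsTrinomialSpacing lam a b) →
      ∀ op : LogLattice.latticeFn lam → LogLattice.latticeFn lam → LogLattice.latticeFn lam,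
        LogLattice.IsSymmetricProduct op → (∃ f g, op f g ≠ 0) →
          ∃ f g h, op (op f g) h ≠ op f (op g h)) ∧
    (lam = 2 → ∀ c : ℝ, c ≠ 0 →
      LogLattice.NotAssociative (LogLattice.prodDyadic lam c) ∧
      LogLattice.DeltaWitness 0 1 (LogLattice.prodDyadic lam c)) ∧
    (lam = LogLattice.plastic → ∀ c₁ c₂ : ℝ, (c₁ ≠ 0 ∨ c₂ ≠ 0) →
      LogLattice.NotAssociative (LogLattice.prodPlastic lam c₁ c₂) ∧
      (c₁ ≠ 0 → LogLattice.DeltaWitness 1 3 (LogLattice.prodPlastic lam c₁ c₂)) ∧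
      (c₂ ≠ 0 → LogLattice.DeltaWitness 4 5 (LogLattice.prodPlastic lam c₁ c₂))) ∧
    (∀ a b : ℕ, LogLattice.IsTrinomialSpacing lam a b → ∀ c : ℝ, c ≠ 0 →
      LogLattice.NotAssociative (LogLattice.prodTrinomial lam a b c) ∧
      LogLattice.DeltaWitness a b (LogLattice.prodTrinomial lam a b c)) := by
  refine ⟨fun _ op hop hne => hop.exists_not_associative hlam hne, ?_, ?_, ?_⟩
  · rintro rfl c hc
    exact LogLattice.prodDyadic_witness hc
  · intro h c₁ c₂ hc
    exact LogLattice.prodPlastic_witness hlam (h ▸ LogLattice.plastic_cube) hc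
  · rintro a b ⟨-, -, -, -, -, -, hab⟩ c hc
    exact LogLattice.prodTrinomial_witness hlam hab hc
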